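/- Let $\mathcal M$ be a finite-dimensional von Neumann algebra with a trace $\tau$, that is, a faithful (not necessarily normalized) positive linear functional with $\tau(ab)=\tau(ba)$. Put $\langle a,b\rangle=\tau(b^*a)$ (and use $\tau\otimes\tau$ in the same way on $\mathcal M\otimes\mathcal M$), $\|a\|_p=\tau(|a|^p)^{1/p}$ for $1\le p<\infty$, $\|a\|_\infty=\|a\|$ (the operator norm), and $H(a)=\tau(-a\log a)$ for $a\ge 0$ (with $0\log 0=0$). Let $k>0$. A good $k$-convolution on $\mathcal M$ is a bilinear map $\ast$ such that $\langle a\ast b,c\rangle=\langle a\otimes b,\Delta(c)\rangle$ for all $a,b,c\in\mathcal M$, where $\Delta:\mathcal M\to\mathcal M\otimes\mathcal M$ is some positive linear map with $\Delta(I)=kI$. A (finite-dimensional) Frobenius von Neumann $k$-algebra (FN $k$-algebra) is a quadruple $(\mathcal M,\tau,\ast,\rho)$ with $\ast$ a good $k$-convolution and $\rho$ an antipode, i.e. a trace-preserving linear anti-$*$-isomorphism of $\mathcal M$ with $\tau((a\ast b)c)=\tau((\rho(c)\ast a)\rho(b))$ for all $a,b,c\in\mathcal M$. Let $d=\tau(I)$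 be its Frobenius–Perron dimension and $\lambda=\min\{\tau(e): e\in\mathcal M \text{ a nonzero projection}\}$. For positive $x,y\in\mathcal M$, $p,q\in[1,\infty]$ and $\epsilon,\eta\in[0,1]$ define the smooth entropy and the smooth convolution entropy by $$H^p_\epsilon(x)=\sup\{H(z): z\in\mathcal M,\ z\ge 0,\ \|z-x\|_p\le\epsilon\},$$ $$H^{p,q}_{\epsilon,\eta}(x\ast y)=\inf\{H(z\ast w): z,w\in\mathcal M,\ z,w\ge 0,\ \|x-z\|_p\le\epsilon,\ \|y-w\|_q\le\eta\}.$$ **Theorem 4.7 (quantum smooth entropic convolution inequality).** For all real $d,\lambda,k$ there is a constant $C=C(d,\lambda,k)\ge 0$ such that the following holds for every finite-dimensional FN $k$-algebra $(\mathcal M,\tau,\ast,\rho)$ with $\tau(I)=d$ and minimal trace of a nonzero projection equal to $\lambda$: for all $p,q\in[1,\infty]$, all $\epsilon,\eta\in[0,1]$ with $$\epsilon+\eta\le\frac{1}{(d+1)(1+k(d+1))},$$ all positive $x,y\in\mathcal M$ with $\|x\|_1=\|y\|_1=k^{-1}$ and all $0\le\theta\le 1$, $$H^{p,q}_{\epsilon,\eta}(x\ast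 y)\ \ge\ \theta H^p_\epsilon(x)+(1-\theta)H^q_\eta(y)-C\,|\epsilon\log\epsilon|-C\,|\eta\log\eta|,$$ where $0\log 0=0$. -/

import Mathlib

open scoped TensorProduct ComplexOrder ENNReal

universe u

noncomputable section

/-- A trace on `M`: a faithful positive tracial linear functional.
(Every linear functional on a finite-dimensional von Neumann algebra is normal.) -/
structure FaithfulTrace (M : Type*) [CStarAlgebra M] [PartialOrder M] where
  /-- The underlying linear functional. -/
  toFun : M →ₗ[ℂ] ℂ
  pos : ∀ x : M, 0 ≤ x → 0 ≤ toFun x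
  faithful : ∀ x : M, 0 ≤ x → toFun x = 0 → x = 0
  tracial : ∀ x y : M, toFun (x * y) = toFun (y * x)

namespace FaithfulTrace

variable {M : Type*} [CStarAlgebra M] [PartialOrder M]

instance : CoeFun (FaithfulTrace M) (fun _ => M → ℂ) := ⟨fun τ => τ.toFun⟩

/-- The product trace `τ ⊗ τ` on `M ⊗ M`. -/
def tensor (τ : FaithfulTrace M) : M ⊗[ℂ] M →ₗ[ℂ] ℂ :=
  LinearMap.mul' ℂ ℂ ∘ₗ TensorProduct.map τ.toFun τ.toFun

/-- The dimension `d = τ(1)`. -/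
def dim (τ : FaithfulTrace M) : ℝ := (τ 1).re

/-- The smallest trace `λ` of a nonzero projection. In finite dimension only finitely many values
occur, so the infimum is a minimum. -/
def minTrace (τ : FaithfulTrace M) : ℝ :=
  sInf {t : ℝ | ∃ e : M, IsStarProjection e ∧ e ≠ 0 ∧ t = (τ e).re}

/-- The von Neumann entropy `H(x) = τ(-x log x)`, with the function `t ↦ -t log t`
(and `0 log 0 = 0`) applied through the functional calculus. -/
def entropy (τ : FaithfulTrace M) (x : M) : ℝ := (τ (cfc Real.negMulLog x)).re

variable [StarOrderedRing M]

/-- The noncommutative `p`-norm: `τ(|x|^p)^(1/p)` for finite `p`, the operator norm for `p = ∞`. -/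
def pNorm (τ : FaithfulTrace M) (p : ℝ≥0∞) (x : M) : ℝ :=
  if p = ∞ then ‖x‖ else (τ (CFC.abs x ^ p.toReal)).re ^ (1 / p.toReal)

/-- The `(p, ε)` smooth entropy `H^p_ε(x)`. -/
def smoothEntropy (τ : FaithfulTrace M) (p : ℝ≥0∞) (ε : ℝ) (x : M) : ℝ :=
  sSup {h : ℝ | ∃ z : M, 0 ≤ z ∧ τ.pNorm p (z - x) ≤ ε ∧ h = τ.entropy z}

end FaithfulTrace

/-- Positivity in `M ⊗ M`. For finite-dimensional `M` the algebraic tensor product is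
the von Neumann tensor product, and its positive elements are the elements `a⋆ a`. -/
def TensorPositive {M : Type*} [CStarAlgebra M] (t : M ⊗[ℂ] M) : Prop :=
  ∃ a : M ⊗[ℂ] M, t = star a * a

/-- A good `k`-comultiplication: a positive linear map `Δ : M → M ⊗ M` with `Δ(1) = k 1`
(its operator norm is then automatically `k`). -/
structure IsGoodComul {M : Type*} [CStarAlgebra M] [PartialOrder M]
    (k : ℝ) (Δ : M →ₗ[ℂ] M ⊗[ℂ] M) : Prop where
  positive : ∀ x : M, 0 ≤ x → TensorPositive (Δ x)
  map_one : Δ 1 = (k : ℂ) • (1 : M ⊗[ℂ] M)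

/-- A good `k`-convolution: a bilinear product induced by a good `k`-comultiplication through
`⟨x ∗ y, z⟩ = ⟨x ⊗ y, Δ(z)⟩`, where `⟨a, b⟩` is the trace of `b⋆ a`. -/
def IsGoodConv {M : Type*} [CStarAlgebra M] [PartialOrder M]
    (k : ℝ) (τ : FaithfulTrace M) (conv : M →ₗ[ℂ] M →ₗ[ℂ] M) : Prop :=
  ∃ Δ : M →ₗ[ℂ] M ⊗[ℂ] M, IsGoodComul k Δ ∧
    ∀ x y z : M, τ (star z * conv x y) = τ.tensor (star (Δ z) * (x ⊗ₜ[ℂ] y))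

/-- An antipode: a trace-preserving `⋆`-anti-isomorphism satisfying Frobenius reciprocity. -/
structure IsAntipode {M : Type*} [CStarAlgebra M] [PartialOrder M]
    (τ : FaithfulTrace M) (conv : M →ₗ[ℂ] M →ₗ[ℂ] M) (ρ : M ≃ₗ[ℂ] M) : Prop where
  map_mul : ∀ x y : M, ρ (x * y) = ρ y * ρ x
  map_star : ∀ x : M, ρ (star x) = star (ρ x)
  trace_preserving : ∀ x : M, τ (ρ x) = τ x
  reciprocity : ∀ x y z : M, τ (conv x y * z) = τ (conv (ρ z) x * ρ y)

/-- A Frobenius von Neumann `k`-algebra structure `(τ, ∗, ρ)` on `M`. -/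
structure FNAlgebra (k : ℝ) (M : Type*) [CStarAlgebra M] [PartialOrder M] where
  k_pos : 0 < k
  /-- The trace. -/
  τ : FaithfulTrace M
  /-- The convolution. -/
  conv : M →ₗ[ℂ] M →ₗ[ℂ] M
  /-- The antipode. -/
  ρ : M ≃ₗ[ℂ] M
  good : IsGoodConv k τ conv
  antipode : IsAntipode τ conv ρ

/-- The smooth convolution entropy `H^{p,q}_{ε,η}(x ∗ y)`. -/
def FNAlgebra.smoothConvEntropy {k : ℝ} {M : Type*} [CStarAlgebra M] [PartialOrder M]
    [StarOrderedRing M] (A : FNAlgebra k M) (p q : ℝ≥0∞) (ε η : ℝ) (x y : M) : ℝ :=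
  sInf {h : ℝ | ∃ z w : M, 0 ≤ z ∧ 0 ≤ w ∧ A.τ.pNorm p (x - z) ≤ ε ∧ A.τ.pNorm q (y - w) ≤ η ∧
    h = A.τ.entropy (A.conv z w)}

end

/-!
Fix `y ≥ 0` with `k τ(y) = 1`. The map `T : c ↦ c ∗ y` is positive, preserves the trace because
`Δ(1) = k`, and is unital by Frobenius reciprocity applied twice (`FNAlgebra.one_conv`). The same
holds for `c ↦ x ∗ c`. A doubly stochastic map does not decrease entropy, and the argument tolerates
an error: if `-δ ≤ T a - b ≤ δ`, then `H(a) ≤ H(b) + d (-δ log δ) + 2 δ (τ(b) + δ d)`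
(`FaithfulTrace.entropy_le`). This single estimate combines the convolution inequality with
Fannes-type continuity.

It is applied with `a = z'` an arbitrary competitor in the smooth entropy of `x` and `b = z ∗ w` an
arbitrary competitor in the smooth convolution entropy. Every nonzero projection has trace at least
`lam > 0`, so a `p`-ball of radius `ε` lies in an operator-norm ball of radius `(1 + 1/lam) ε`
(`FaithfulTrace.norm_le_of_pNorm_le`); as convolution by a fixed positive element is monotone and
maps `1` to a multiple of `1`, `z' ∗ y` and `z ∗ w` differ by at most a constant times `ε + η`
(`FNAlgebra.entropy_left_le`). The terms linear in `ε + η` are absorbed into `|ε log ε|` and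
`|η log η|`, because the bound on `ε + η` keeps both numbers away from `1` (`error_le`). Averaging
the estimates for `x` and for `y` with weights `θ` and `1 - θ` gives the claim.
-/

noncomputable section

/-! ### Spectral projections in finite dimension -/

section Spectral

variable {M : Type*} [CStarAlgebra M] [FiniteDimensional ℂ M]

/-- The spectrum consists of roots of the minimal polynomial. -/
theorem finite_spectrum_real (a : M) : (spectrum ℝ a).Finite := by
  have : FiniteDimensional ℝ M := FiniteDimensional.complexToReal M
  have hne : minpoly ℝ a ≠ 0 := minpoly.ne_zero (Algebra.IsIntegral.isIntegral a)
  refine ((minpoly ℝ a).roots.toFinset.finite_toSet).subset fun t ht => ?_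
  have h := spectrum.subset_polynomial_aeval a (minpoly ℝ a) ⟨t, ht, rfl⟩
  rw [minpoly.aeval] at h
  cases subsingleton_or_nontrivial M
  · simp [spectrum.of_subsingleton] at ht
  · rw [spectrum.zero_eq] at h
    simpa [hne] using h

theorem continuousOn_spectrum (f : ℝ → ℝ) (a : M) : ContinuousOn f (spectrum ℝ a) :=
  (finite_spectrum_real a).continuousOn f

/-- The eigenvalues of `a`, as a finite set. -/
def eigenvalues (a : M) : Finset ℝ := (finite_spectrum_real a).toFinset

theorem mem_eigenvalues {a : M} {t : ℝ} : t ∈ eigenvalues a ↔ t ∈ spectrum ℝ a := by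
  simp [eigenvalues]

/-- The spectral projection of a self-adjoint element `a` at `t`. -/
def spectralProj (a : M) (t : ℝ) : M := cfc (fun s : ℝ => if s = t then (1 : ℝ) else 0) a

theorem spectralProj_mul_self (a : M) (t : ℝ) :
    spectralProj a t * spectralProj a t = spectralProj a t := by
  unfold spectralProj
  rw [← cfc_mul _ _ a (continuousOn_spectrum _ a) (continuousOn_spectrum _ a)]
  congr 1
  ext s
  split_ifs <;> simp

theorem isStarProjection_spectralProj (a : M) (t : ℝ) : IsStarProjection (spectralProj a t) :=
  ⟨spectralProj_mul_self a t, cfc_predicate _ a⟩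

theorem cfc_eq_sum_spectralProj (f : ℝ → ℝ) (a : M) :
    cfc f a = ∑ t ∈ eigenvalues a, f t • spectralProj a t := by
  have h : cfc f a
      = cfc (∑ t ∈ eigenvalues a, fun s : ℝ => f t * if s = t then (1 : ℝ) else 0) a := by
    refine cfc_congr fun s hs => ?_
    simp [Finset.sum_apply, mem_eigenvalues, hs]
  rw [h, cfc_sum _ a _ fun t _ => continuousOn_spectrum _ a]
  exact Finset.sum_congr rfl fun t _ => cfc_const_mul _ _ a (continuousOn_spectrum _ a)

theorem sum_spectralProj {a : M} (ha : IsSelfAdjoint a) :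
    ∑ t ∈ eigenvalues a, spectralProj a t = 1 := by
  have h := cfc_eq_sum_spectralProj (fun _ => 1) a
  rw [cfc_const_one ℝ a] at h
  simpa using h.symm

theorem mul_spectralProj {a : M} (ha : IsSelfAdjoint a) (t : ℝ) :
    a * spectralProj a t = t • spectralProj a t := by
  have h := cfc_mul id (fun s : ℝ => if s = t then (1 : ℝ) else 0) a
    (continuousOn_spectrum _ a) (continuousOn_spectrum _ a)
  rw [cfc_id ℝ a] at h
  unfold spectralProj
  rw [← h, ← cfc_const_mul _ _ a (continuousOn_spectrum _ a)]
  congr 1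
  ext s
  by_cases hs : s = t <;> simp [hs]

theorem spectralProj_ne_zero {a : M} (ha : IsSelfAdjoint a) {t : ℝ} (ht : t ∈ spectrum ℝ a) :
    spectralProj a t ≠ 0 := by
  intro h
  have h' : cfc (fun s : ℝ => if s = t then (1 : ℝ) else 0) a = cfc (fun _ : ℝ => (0 : ℝ)) a := by
    rw [cfc_const_zero]
    exact h
  simpa using eqOn_of_cfc_eq_cfc h' (continuousOn_spectrum _ a) (continuousOn_spectrum _ a) ha ht

end Spectral

/-! ### The trace as a positive functional -/

namespace FaithfulTrace

variable {M : Type*} [CStarAlgebra M] [PartialOrder M]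

/-- The real part of a trace, as a real linear functional. -/
def reLin (τ : FaithfulTrace M) : M →ₗ[ℝ] ℝ := Complex.reLm ∘ₗ τ.toFun.restrictScalars ℝ

theorem reLin_apply (τ : FaithfulTrace M) (x : M) : τ.reLin x = (τ x).re := rfl

theorem reLin_one (τ : FaithfulTrace M) : τ.reLin 1 = τ.dim := rfl

theorem reLin_nonneg (τ : FaithfulTrace M) {x : M} (hx : 0 ≤ x) : 0 ≤ τ.reLin x :=
  (Complex.nonneg_iff.1 (τ.pos x hx)).1

variable [StarOrderedRing M]

theorem reLin_mono (τ : FaithfulTrace M) {x y : M} (h : x ≤ y) : τ.reLin x ≤ τ.reLin y := by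
  have := τ.reLin_nonneg (sub_nonneg.2 h)
  rwa [map_sub, sub_nonneg] at this

theorem dim_nonneg (τ : FaithfulTrace M) : 0 ≤ τ.dim := τ.reLin_nonneg zero_le_one

theorem eq_zero_of_trace_star_mul_self (τ : FaithfulTrace M) {x : M} (h : τ (star x * x) = 0) :
    x = 0 := by
  simpa using τ.faithful _ (star_mul_self_nonneg x) h

theorem trace_im_of_isSelfAdjoint (τ : FaithfulTrace M) {x : M} (hx : IsSelfAdjoint x) :
    (τ x).im = 0 := by
  rw [← CFC.posPart_sub_negPart x hx, map_sub, Complex.sub_im,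
    ← (Complex.nonneg_iff.1 (τ.pos _ (CFC.posPart_nonneg x))).2,
    ← (Complex.nonneg_iff.1 (τ.pos _ (CFC.negPart_nonneg x))).2, sub_zero]

open ComplexStarModule in
theorem trace_star (τ : FaithfulTrace M) (x : M) : τ (star x) = star (τ x) := by
  have hre := τ.trace_im_of_isSelfAdjoint (realPart x).2
  have him := τ.trace_im_of_isSelfAdjoint (imaginaryPart x).2
  have hx := realPart_add_I_smul_imaginaryPart x
  have hs : star x = (realPart x : M) - Complex.I • (imaginaryPart x : M) := by
    conv_lhs => rw [← hx]
    rw [star_add, star_smul, (realPart x).2.star_eq, (imaginaryPart x).2.star_eq]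
    simp [sub_eq_add_neg]
  conv_rhs => rw [← hx]
  rw [hs]
  apply Complex.ext <;> simp [hre, him]

theorem reLin_mul_nonneg (τ : FaithfulTrace M) {x q : M} (hx : 0 ≤ x) (hq : IsStarProjection q) :
    0 ≤ τ.reLin (x * q) := by
  have h : τ (x * q) = τ (q * x * q) := by
    rw [τ.tracial (q * x) q, ← mul_assoc, hq.isIdempotentElem.eq, τ.tracial]
  rw [reLin_apply, h]
  exact τ.reLin_nonneg (hq.isSelfAdjoint.conjugate_nonneg hx)

/-- The positive cone of `M` is self-dual for the trace pairing. -/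
theorem nonneg_of_trace_mul_nonneg (τ : FaithfulTrace M) {h : M}
    (H : ∀ c : M, 0 ≤ c → 0 ≤ τ (c * h)) : 0 ≤ h := by
  -- Pairing `h` with its imaginary part shows that the latter vanishes.
  have hreal : ∀ c : M, IsSelfAdjoint c → (τ (c * h)).im = 0 := by
    intro c hc
    rw [← CFC.posPart_sub_negPart c hc, sub_mul, map_sub, Complex.sub_im,
      ← (Complex.nonneg_iff.1 (H _ (CFC.posPart_nonneg c))).2,
      ← (Complex.nonneg_iff.1 (H _ (CFC.negPart_nonneg c))).2, sub_zero]
  have hx := realPart_add_I_smul_imaginaryPart h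
  set r : M := (realPart h : M) with hr
  set i : M := (imaginaryPart h : M) with hi
  have hrs : IsSelfAdjoint r := (realPart h).2
  have his : IsSelfAdjoint i := (imaginaryPart h).2
  have hprod : (τ (i * r)).im = 0 := by
    have h1 := τ.trace_star (i * r)
    rw [star_mul, hrs.star_eq, his.star_eq, τ.tracial] at h1
    exact Complex.conj_eq_iff_im.1 h1.symm
  have hisq : (τ (i * i)).re = 0 := by
    have h1 := hreal i his
    rw [← hx, mul_add, mul_smul_comm, map_add, map_smul] at h1
    simpa [hprod] using h1
  have hi0 : i = 0 := by
    apply τ.eq_zero_of_trace_star_mul_self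
    rw [his.star_eq]
    apply Complex.ext
    · exact hisq
    · refine τ.trace_im_of_isSelfAdjoint ?_
      rw [IsSelfAdjoint, star_mul, his.star_eq]
  have hsa : IsSelfAdjoint h := by
    rw [← hx, hi0, smul_zero, add_zero]
    exact hrs
  -- Pairing `h` with its negative part shows that the latter vanishes.
  have hneg : h⁻ * h = -(star h⁻ * h⁻) := by
    have h1 : h⁻ * h = h⁻ * (h⁺ - h⁻) := by rw [CFC.posPart_sub_negPart h hsa]
    rw [h1, mul_sub, CFC.negPart_mul_posPart, (CFC.negPart_nonneg h).isSelfAdjoint.star_eq]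
    simp
  have hn : h⁻ = 0 := by
    apply τ.eq_zero_of_trace_star_mul_self
    have h1 := H _ (CFC.negPart_nonneg h)
    rw [hneg, map_neg] at h1
    exact le_antisymm (neg_nonneg.1 h1) (τ.pos _ (star_mul_self_nonneg _))
  exact (CFC.negPart_eq_zero_iff h hsa).1 hn

/-- The trace pairing is nondegenerate. -/
theorem eq_of_trace_mul_eq (τ : FaithfulTrace M) {x y : M} (h : ∀ c, τ (x * c) = τ (y * c)) :
    x = y := by
  rw [← sub_eq_zero]
  apply τ.eq_zero_of_trace_star_mul_self
  rw [τ.tracial, sub_mul, map_sub, h, sub_self]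

theorem reLin_le_norm_mul_dim (τ : FaithfulTrace M) {x : M} (hx : 0 ≤ x) :
    τ.reLin x ≤ ‖x‖ * τ.dim := by
  have := τ.reLin_mono hx.isSelfAdjoint.le_algebraMap_norm_self
  rwa [Algebra.algebraMap_eq_smul_one, map_smul, reLin_one] at this

end FaithfulTrace

/-! ### Entropy under doubly stochastic maps -/

/-- The graph of `t ↦ -t log t` lies below its tangent at `s`. -/
theorem negMulLog_le_tangent {s t : ℝ} (hs : 0 < s) (ht : 0 ≤ t) :
    Real.negMulLog t ≤ s - (Real.log s + 1) * t := by
  rcases ht.eq_or_lt with rfl | ht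
  · simpa using hs.le
  · have h := Real.log_le_sub_one_of_pos (div_pos hs ht)
    rw [Real.log_div hs.ne' ht.ne'] at h
    have h2 := mul_le_mul_of_nonneg_left h ht.le
    have h3 : t * (s / t - 1) = s - t := by field_simp
    rw [Real.negMulLog]
    nlinarith

theorem negMulLog_add_le {s t : ℝ} (hs : 0 ≤ s) (ht : 0 ≤ t) :
    Real.negMulLog (s + t) ≤ Real.negMulLog s + Real.negMulLog t := by
  rcases hs.eq_or_lt with rfl | hs
  · simp
  rcases ht.eq_or_lt with rfl | ht
  · simp
  have h1 := Real.log_le_log hs (by linarith : s ≤ s + t)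
  have h2 := Real.log_le_log ht (by linarith : t ≤ s + t)
  simp only [Real.negMulLog]
  nlinarith

namespace FaithfulTrace

variable {M : Type*} [CStarAlgebra M] [PartialOrder M] [StarOrderedRing M] [FiniteDimensional ℂ M]

theorem entropy_le_of_pos (τ : FaithfulTrace M) (T : M →ₗ[ℂ] M) (hT : ∀ c, 0 ≤ c → 0 ≤ T c)
    (hT1 : T 1 = 1) (hTτ : ∀ c, τ (T c) = τ c) {a b : M} (ha : 0 ≤ a) (hb : 0 ≤ b) {δ : ℝ}
    (hδ : 0 < δ) (h₁ : T a ≤ b + δ • (1 : M)) (h₂ : b ≤ T a + δ • (1 : M)) :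
    τ.entropy a ≤ τ.entropy b + τ.dim * Real.negMulLog δ + 2 * δ * (τ.reLin b + δ * τ.dim) := by
  set q := spectralProj b with hq
  set S := eigenvalues b with hS
  have hproj : ∀ t, IsStarProjection (q t) := isStarProjection_spectralProj b
  have hqt : ∀ t, 0 ≤ τ.reLin (q t) := fun t => τ.reLin_nonneg (hproj t).nonneg
  have hsum : ∑ t ∈ S, q t = 1 := sum_spectralProj hb.isSelfAdjoint
  have key : ∀ t ∈ S, τ.reLin (T (cfc Real.negMulLog a) * q t)
      ≤ (Real.negMulLog t + Real.negMulLog δ + 2 * δ * (t + δ)) * τ.reLin (q t) := by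
    intro t ht
    have ht0 : 0 ≤ t := spectrum_nonneg_of_nonneg hb (mem_eigenvalues.1 ht)
    have hs : 0 < t + δ := by linarith
    have htan : cfc Real.negMulLog a ≤ (t + δ) • (1 : M) - (Real.log (t + δ) + 1) • a := by
      have h1 : cfc (fun x : ℝ => (t + δ) - (Real.log (t + δ) + 1) * x) a
          = (t + δ) • (1 : M) - (Real.log (t + δ) + 1) • a := by
        rw [cfc_sub _ _ a (continuousOn_spectrum _ a) (continuousOn_spectrum _ a),
          cfc_const _ a, cfc_const_mul_id _ a, Algebra.algebraMap_eq_smul_one]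
      rw [← h1]
      exact cfc_mono (fun x hx => negMulLog_le_tangent hs (spectrum_nonneg_of_nonneg ha hx))
        (continuousOn_spectrum _ a) (continuousOn_spectrum _ a)
    have hmain : τ.reLin (T (cfc Real.negMulLog a) * q t)
        ≤ (t + δ) * τ.reLin (q t) - (Real.log (t + δ) + 1) * τ.reLin (T a * q t) := by
      have h1 := τ.reLin_mul_nonneg (hT _ (sub_nonneg.2 htan)) (hproj t)
      rw [map_sub, map_sub, LinearMap.map_smul_of_tower, LinearMap.map_smul_of_tower, hT1, sub_mul,
        sub_mul, smul_mul_assoc, smul_mul_assoc, one_mul, map_sub, map_sub, map_smul, map_smul,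
        smul_eq_mul, smul_eq_mul] at h1
      linarith
    have hbq : τ.reLin (b * q t) = t * τ.reLin (q t) := by
      rw [hq, mul_spectralProj hb.isSelfAdjoint, map_smul, smul_eq_mul]
    have hu := τ.reLin_mul_nonneg (sub_nonneg.2 h₁) (hproj t)
    rw [sub_mul, add_mul, smul_mul_assoc, one_mul, map_sub, map_add, map_smul, smul_eq_mul,
      hbq] at hu
    have hl := τ.reLin_mul_nonneg (sub_nonneg.2 h₂) (hproj t)
    rw [sub_mul, add_mul, smul_mul_assoc, one_mul, map_sub, map_add, map_smul, smul_eq_mul,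
      hbq] at hl
    have hlog : Real.log (t + δ) + 1 ≤ t + δ := by
      linarith [Real.log_le_sub_one_of_pos hs]
    have hadd := mul_le_mul_of_nonneg_right (negMulLog_add_le ht0 hδ.le) (hqt t)
    have hv : 0 ≤ (t + δ) * τ.reLin (q t) - τ.reLin (T a * q t) := by linarith
    have hv2 : (t + δ) * τ.reLin (q t) - τ.reLin (T a * q t) ≤ 2 * δ * τ.reLin (q t) := by linarith
    have h3 := mul_le_mul_of_nonneg_right hlog hv
    have h4 := mul_le_mul_of_nonneg_left hv2 hs.le
    rw [Real.negMulLog] at hadd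
    linarith
  have hsplit : τ.entropy a = ∑ t ∈ S, τ.reLin (T (cfc Real.negMulLog a) * q t) := by
    rw [← map_sum, ← Finset.mul_sum, hsum, mul_one, reLin_apply, hTτ]
    rfl
  have hent : τ.entropy b = ∑ t ∈ S, Real.negMulLog t * τ.reLin (q t) := by
    rw [entropy, ← reLin_apply, cfc_eq_sum_spectralProj, map_sum]
    simp [hq, hS]
  have htr : τ.reLin b = ∑ t ∈ S, t * τ.reLin (q t) := by
    conv_lhs => rw [← cfc_id ℝ b, cfc_eq_sum_spectralProj, map_sum]
    simp [hq, hS]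
  have hdim : τ.dim = ∑ t ∈ S, τ.reLin (q t) := by
    rw [← map_sum, hsum, reLin_one]
  rw [hsplit]
  refine (Finset.sum_le_sum key).trans_eq ?_
  rw [hent, htr, hdim]
  simp only [Finset.sum_mul, Finset.mul_sum, ← Finset.sum_add_distrib]
  exact Finset.sum_congr rfl fun t _ => by ring

/-- Entropy is almost increased by a doubly stochastic map: the inequality is the trace of the
tangent-line inequality for `-t log t`, taken on each spectral projection of `b` at the
corresponding eigenvalue shifted by `δ`. The shift keeps the logarithm away from its singularity. -/
theorem entropy_le (τ : FaithfulTrace M) (T : M →ₗ[ℂ] M) (hT : ∀ c, 0 ≤ c → 0 ≤ T c)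
    (hT1 : T 1 = 1) (hTτ : ∀ c, τ (T c) = τ c) {a b : M} (ha : 0 ≤ a) (hb : 0 ≤ b) {δ : ℝ}
    (hδ : 0 ≤ δ) (h₁ : T a ≤ b + δ • (1 : M)) (h₂ : b ≤ T a + δ • (1 : M)) :
    τ.entropy a ≤ τ.entropy b + τ.dim * Real.negMulLog δ + 2 * δ * (τ.reLin b + δ * τ.dim) := by
  have hcont : Continuous fun s : ℝ =>
      τ.entropy b + τ.dim * Real.negMulLog s + 2 * s * (τ.reLin b + s * τ.dim) := by
    have := Real.continuous_negMulLog
    fun_prop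
  refine ge_of_tendsto ((hcont.tendsto δ).mono_left (nhdsWithin_le_nhds (s := Set.Ioi δ))) ?_
  filter_upwards [self_mem_nhdsWithin] with s hs
  have hle : δ • (1 : M) ≤ s • (1 : M) := smul_le_smul_of_nonneg_right (le_of_lt hs) zero_le_one
  exact τ.entropy_le_of_pos T hT hT1 hTτ ha hb (hδ.trans_lt hs)
    (h₁.trans (add_le_add_right hle _)) (h₂.trans (add_le_add_right hle _))

end FaithfulTrace

/-! ### The smallest trace of a projection and the `p`-norms -/

namespace FaithfulTrace

variable {M : Type*} [CStarAlgebra M] [PartialOrder M] [StarOrderedRing M]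

theorem dim_pos [Nontrivial M] (τ : FaithfulTrace M) : 0 < τ.dim := by
  refine τ.dim_nonneg.lt_of_ne fun h => one_ne_zero (τ.faithful 1 zero_le_one ?_)
  exact Complex.ext h.symm (τ.trace_im_of_isSelfAdjoint (.one M))

theorem reLin_pos_of_isStarProjection (τ : FaithfulTrace M) {e : M} (he : IsStarProjection e)
    (h0 : e ≠ 0) : 0 < τ.reLin e := by
  refine (τ.reLin_nonneg he.nonneg).lt_of_ne fun h => h0 (τ.faithful e he.nonneg ?_)
  exact Complex.ext h.symm (τ.trace_im_of_isSelfAdjoint he.isSelfAdjoint)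

theorem minTrace_le (τ : FaithfulTrace M) {e : M} (he : IsStarProjection e) (h0 : e ≠ 0) :
    τ.minTrace ≤ τ.reLin e := by
  refine csInf_le ⟨0, ?_⟩ ⟨e, he, h0, rfl⟩
  rintro t ⟨f, hf, -, rfl⟩
  exact τ.reLin_nonneg hf.nonneg

theorem pNorm_zero (τ : FaithfulTrace M) {p : ℝ≥0∞} (hp : 1 ≤ p) : τ.pNorm p 0 = 0 := by
  unfold pNorm
  split_ifs with h
  · exact norm_zero
  · have hr : p.toReal ≠ 0 := (ENNReal.toReal_pos (one_pos.trans_le hp).ne' h).ne'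
    rw [CFC.abs_zero, ← CFC.rpow_eq_pow, CFC.zero_rpow hr, map_zero, Complex.zero_re,
      Real.zero_rpow (one_div_ne_zero hr)]

theorem pNorm_one_of_nonneg (τ : FaithfulTrace M) {x : M} (hx : 0 ≤ x) :
    τ.pNorm 1 x = τ.reLin x := by
  rw [pNorm, if_neg ENNReal.one_ne_top, ENNReal.toReal_one, CFC.abs_of_nonneg x, CFC.rpow_one x]
  simp [reLin_apply]

variable [FiniteDimensional ℂ M]

/-- The smallest trace of a nonzero projection is positive: nonzero projections form a compact set,
being the projections of norm one. -/
theorem minTrace_pos [Nontrivial M] (τ : FaithfulTrace M) : 0 < τ.minTrace := by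
  have : FiniteDimensional ℝ M := FiniteDimensional.complexToReal M
  have : ProperSpace M := FiniteDimensional.proper ℝ M
  have hset : {e : M | IsStarProjection e ∧ e ≠ 0}
      = {e : M | e * e = e} ∩ {e : M | star e = e} ∩ Metric.sphere 0 1 := by
    ext e
    simp only [Set.mem_ofPred_eq, Set.mem_inter_iff, mem_sphere_zero_iff_norm]
    constructor
    · rintro ⟨he, h0⟩
      refine ⟨⟨he.isIdempotentElem, he.isSelfAdjoint⟩, ?_⟩
      have h1 := CStarRing.norm_star_mul_self (x := e)
      rw [he.isSelfAdjoint.star_eq, he.isIdempotentElem.eq] at h1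
      have h2 : ‖e‖ ≠ 0 := norm_ne_zero_iff.2 h0
      exact mul_left_cancel₀ h2 (by linarith)
    · rintro ⟨⟨h1, h2⟩, h3⟩
      refine ⟨⟨h1, h2⟩, fun h => ?_⟩
      simp [h] at h3
  have hcomp : IsCompact {e : M | IsStarProjection e ∧ e ≠ 0} := by
    rw [hset]
    refine (isCompact_sphere (0 : M) 1).inter_left (IsClosed.inter ?_ ?_)
    · exact isClosed_eq (by fun_prop) (by fun_prop)
    · exact isClosed_eq (by fun_prop) (by fun_prop)
  obtain ⟨e, ⟨he, h0⟩, hmin⟩ := hcomp.exists_isMinOn ⟨1, .one _, one_ne_zero⟩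
    (τ.reLin.continuous_of_finiteDimensional.continuousOn)
  refine (τ.reLin_pos_of_isStarProjection he h0).trans_le
    (le_csInf ⟨_, e, he, h0, rfl⟩ ?_)
  rintro t ⟨f, hf, hf0, rfl⟩
  exact hmin ⟨hf, hf0⟩

/-- The spectral projection of `a` at its largest eigenvalue `‖a‖` bounds `a ^ r` from below. -/
theorem minTrace_mul_norm_rpow_le [Nontrivial M] (τ : FaithfulTrace M) {a : M} (ha : 0 ≤ a)
    (r : ℝ) : τ.minTrace * ‖a‖ ^ r ≤ τ.reLin (a ^ r) := by
  have hmem := CStarAlgebra.norm_mem_spectrum_of_nonneg (a := a)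
  have hle : ‖a‖ ^ r • spectralProj a ‖a‖ ≤ a ^ r := by
    rw [CFC.rpow_eq_cfc_real, spectralProj, ← cfc_const_mul _ _ a (continuousOn_spectrum _ a)]
    refine cfc_mono (fun t ht => ?_) (continuousOn_spectrum _ a) (continuousOn_spectrum _ a)
    by_cases h : t = ‖a‖
    · simp [h]
    · simpa [h] using Real.rpow_nonneg (spectrum_nonneg_of_nonneg ha ht) r
  have h1 := τ.reLin_mono hle
  rw [map_smul, smul_eq_mul] at h1
  have h2 := τ.minTrace_le (isStarProjection_spectralProj a ‖a‖)
    (spectralProj_ne_zero ha.isSelfAdjoint hmem)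
  nlinarith [Real.rpow_nonneg (norm_nonneg a) r]

theorem norm_le_of_pNorm_le [Nontrivial M] (τ : FaithfulTrace M) {p : ℝ≥0∞} (hp : 1 ≤ p) {c : M}
    {ε : ℝ} (h : τ.pNorm p c ≤ ε) : ‖c‖ ≤ (1 + τ.minTrace⁻¹) * ε := by
  have hlam := τ.minTrace_pos
  have hinv := inv_pos.2 hlam
  unfold pNorm at h
  split_ifs at h with hpt
  · nlinarith [norm_nonneg c]
  · have hr : 1 ≤ p.toReal := by simpa using ENNReal.toReal_mono hpt hp
    set r := p.toReal
    have hr0 : 0 < r := by linarith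
    have hm := τ.minTrace_mul_norm_rpow_le (CFC.abs_nonneg c) r
    rw [CFC.norm_abs] at hm
    set t := τ.reLin (CFC.abs c ^ r) with ht
    have hmr : ‖c‖ ^ r ≤ τ.minTrace⁻¹ * t := by
      rw [inv_mul_eq_div, le_div_iff₀ hlam]
      linarith
    have ht0 : 0 ≤ t := (mul_nonneg hlam.le (Real.rpow_nonneg (norm_nonneg c) r)).trans hm
    calc ‖c‖ = (‖c‖ ^ r) ^ (1 / r) := by
          rw [← Real.rpow_mul (norm_nonneg c), mul_one_div_cancel hr0.ne', Real.rpow_one]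
      _ ≤ (τ.minTrace⁻¹ * t) ^ (1 / r) := by gcongr
      _ = τ.minTrace⁻¹ ^ (1 / r) * t ^ (1 / r) := Real.mul_rpow hinv.le ht0
      _ ≤ (1 + τ.minTrace⁻¹) * ε := by
          refine mul_le_mul ?_ h (Real.rpow_nonneg ht0 _) (by linarith)
          calc τ.minTrace⁻¹ ^ (1 / r) ≤ (1 + τ.minTrace⁻¹) ^ (1 / r) := by
                gcongr
                linarith
            _ ≤ (1 + τ.minTrace⁻¹) ^ (1 : ℝ) :=
                Real.rpow_le_rpow_of_exponent_le (by linarith) ((div_le_one hr0).2 hr)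
            _ = 1 + τ.minTrace⁻¹ := Real.rpow_one _

end FaithfulTrace

theorem le_add_smul_one_of_norm_sub_le {M : Type*} [CStarAlgebra M] [PartialOrder M]
    [StarOrderedRing M] {a b : M} (ha : 0 ≤ a) (hb : 0 ≤ b) {r : ℝ} (h : ‖a - b‖ ≤ r) :
    a ≤ b + r • (1 : M) := by
  have hs : IsSelfAdjoint (a - b) := ha.isSelfAdjoint.sub hb.isSelfAdjoint
  have h1 := hs.le_algebraMap_norm_self
  rw [Algebra.algebraMap_eq_smul_one] at h1
  rw [← sub_le_iff_le_add']
  exact h1.trans (smul_le_smul_of_nonneg_right h zero_le_one)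

/-! ### Convolution as a doubly stochastic map -/

namespace FaithfulTrace

variable {M : Type*} [CStarAlgebra M] [PartialOrder M]

theorem tensor_tmul (τ : FaithfulTrace M) (x y : M) : τ.tensor (x ⊗ₜ[ℂ] y) = τ x * τ y := by
  simp [tensor]

theorem tensor_mul_comm (τ : FaithfulTrace M) (s t : M ⊗[ℂ] M) :
    τ.tensor (s * t) = τ.tensor (t * s) := by
  induction s using TensorProduct.induction_on with
  | zero => simp
  | add s₁ s₂ h₁ h₂ => rw [add_mul, mul_add, map_add, map_add, h₁, h₂]
  | tmul a b =>
    induction t using TensorProduct.induction_on with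
    | zero => simp
    | add t₁ t₂ h₁ h₂ => rw [add_mul, mul_add, map_add, map_add, h₁, h₂]
    | tmul c e =>
      rw [Algebra.TensorProduct.tmul_mul_tmul, Algebra.TensorProduct.tmul_mul_tmul, tensor_tmul,
        tensor_tmul, τ.tracial a c, τ.tracial b e]

variable [StarOrderedRing M]

theorem posSemidef_gram (τ : FaithfulTrace M) {ι : Type*} [Fintype ι] (a : ι → M) :
    (Matrix.of fun i j => τ (star (a i) * a j)).PosSemidef := by
  refine Matrix.PosSemidef.of_dotProduct_mulVec_nonneg ?_ fun v => ?_
  · ext i j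
    rw [Matrix.conjTranspose_apply, Matrix.of_apply, Matrix.of_apply, ← τ.trace_star, star_mul,
      star_star]
  · have h : star v ⬝ᵥ (Matrix.of fun i j => τ (star (a i) * a j)).mulVec v
        = τ (star (∑ i, v i • a i) * ∑ j, v j • a j) := by
      simp only [dotProduct, Matrix.mulVec, star_sum, Finset.sum_mul, Finset.mul_sum, map_sum,
        star_smul, smul_mul_assoc, mul_smul_comm, map_smul, smul_eq_mul, Matrix.of_apply,
        Pi.star_apply]
      rw [Finset.sum_comm]
      exact Finset.sum_congr rfl fun i _ => Finset.sum_congr rfl fun j _ => by ring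
    rw [h]
    exact τ.pos _ (star_mul_self_nonneg _)

/-- The product trace is positive: on a sum of elementary tensors, `(τ ⊗ τ)(t⋆ t)` is the sum of
the entries of the Hadamard product of two Gram matrices. -/
theorem tensor_star_mul_self_nonneg (τ : FaithfulTrace M) (t : M ⊗[ℂ] M) :
    0 ≤ τ.tensor (star t * t) := by
  classical
  obtain ⟨S, rfl⟩ := TensorProduct.exists_finset t
  have h := ((τ.posSemidef_gram fun i : S => i.1.1).hadamard
    (τ.posSemidef_gram fun i : S => i.1.2)).dotProduct_mulVec_nonneg 1
  have h2 : τ.tensor (star (∑ i ∈ S, i.1 ⊗ₜ[ℂ] i.2) * ∑ i ∈ S, i.1 ⊗ₜ[ℂ] i.2)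
      = ∑ i : S, ∑ j : S, τ (star i.1.1 * j.1.1) * τ (star i.1.2 * j.1.2) := by
    rw [← Finset.sum_coe_sort S]
    simp only [star_sum, Finset.sum_mul, Finset.mul_sum, map_sum, TensorProduct.star_tmul,
      Algebra.TensorProduct.tmul_mul_tmul, tensor_tmul]
    rw [Finset.sum_comm]
  rw [h2]
  simpa [dotProduct, Matrix.mulVec, Matrix.hadamard] using h

end FaithfulTrace

namespace FNAlgebra

variable {M : Type*} [CStarAlgebra M] [PartialOrder M] {k : ℝ} (A : FNAlgebra k M)

theorem trace_conv (x y : M) : A.τ (A.conv x y) = k * (A.τ x * A.τ y) := by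
  obtain ⟨Δ, hΔ, h⟩ := A.good
  have := h x y 1
  rw [star_one, one_mul, hΔ.map_one, star_smul, star_one, smul_mul_assoc, one_mul, map_smul,
    FaithfulTrace.tensor_tmul] at this
  simpa using this

theorem antipode_one : A.ρ 1 = 1 := by
  have h := A.antipode.map_mul 1 (A.ρ.symm 1)
  rw [one_mul, A.ρ.apply_symm_apply, one_mul] at h
  exact h.symm

section

variable [StarOrderedRing M]

/-- Applying Frobenius reciprocity twice turns `τ((1 ∗ y) c)` into `τ(ρ²(y) ∗ ρ(c))`. -/
theorem one_conv (y : M) : A.conv 1 y = (k * A.τ y) • (1 : M) := by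
  refine A.τ.eq_of_trace_mul_eq fun c => ?_
  rw [A.antipode.reciprocity, A.antipode.reciprocity, A.antipode_one, mul_one, A.trace_conv,
    A.antipode.trace_preserving, A.antipode.trace_preserving, A.antipode.trace_preserving,
    smul_mul_assoc, one_mul, map_smul, smul_eq_mul]
  ring

theorem conv_one (x : M) : A.conv x 1 = (k * A.τ x) • (1 : M) := by
  refine A.τ.eq_of_trace_mul_eq fun c => ?_
  rw [A.antipode.reciprocity, A.antipode_one, mul_one, A.trace_conv,
    A.antipode.trace_preserving, smul_mul_assoc, one_mul, map_smul, smul_eq_mul]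
  ring

/-- Pairing `x ∗ y` with `c = c⋆ ≥ 0` gives `(τ ⊗ τ)(Δ(c) (x ⊗ y))`, which is the product trace of a
square because `Δ(c)` and `x ⊗ y` both factor. -/
theorem conv_nonneg {x y : M} (hx : 0 ≤ x) (hy : 0 ≤ y) : 0 ≤ A.conv x y := by
  obtain ⟨Δ, hΔ, h⟩ := A.good
  refine A.τ.nonneg_of_trace_mul_nonneg fun c hc => ?_
  obtain ⟨t, ht⟩ := hΔ.positive c hc
  obtain ⟨a, rfl⟩ := CStarAlgebra.nonneg_iff_eq_mul_star_self.1 hx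
  obtain ⟨b, rfl⟩ := CStarAlgebra.nonneg_iff_eq_mul_star_self.1 hy
  have h1 := h (a * star a) (b * star b) c
  have h2 : star (Δ c) * ((a * star a) ⊗ₜ[ℂ] (b * star b))
      = star t * (t * (a ⊗ₜ[ℂ] b) * star (a ⊗ₜ[ℂ] b)) := by
    rw [ht, star_mul, star_star, TensorProduct.star_tmul, mul_assoc, mul_assoc,
      Algebra.TensorProduct.tmul_mul_tmul]
  rw [hc.isSelfAdjoint.star_eq, h2, A.τ.tensor_mul_comm, mul_assoc, A.τ.tensor_mul_comm] at h1
  rw [h1]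
  have h3 := A.τ.tensor_star_mul_self_nonneg (t * (a ⊗ₜ[ℂ] b))
  rw [star_mul] at h3
  exact h3

theorem conv_mono_left {x x' y : M} (h : x ≤ x') (hy : 0 ≤ y) : A.conv x y ≤ A.conv x' y := by
  have := A.conv_nonneg (sub_nonneg.2 h) hy
  rwa [map_sub, LinearMap.sub_apply, sub_nonneg] at this

theorem conv_mono_right {x y y' : M} (hx : 0 ≤ x) (h : y ≤ y') : A.conv x y ≤ A.conv x y' := by
  have := A.conv_nonneg hx (sub_nonneg.2 h)
  rwa [map_sub, sub_nonneg] at this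

end

end FNAlgebra

/-! ### Comparison of the entropies of nearby factors and of their convolution -/

namespace FNAlgebra

variable {M : Type*} [CStarAlgebra M] [PartialOrder M] [StarOrderedRing M] {k : ℝ}
  (A : FNAlgebra k M)

theorem trace_eq_reLin {x : M} (hx : 0 ≤ x) : A.τ x = (A.τ.reLin x : ℂ) :=
  Complex.ext rfl (A.τ.trace_im_of_isSelfAdjoint hx.isSelfAdjoint)

theorem one_conv_of_nonneg {y : M} (hy : 0 ≤ y) :
    A.conv 1 y = (k * A.τ.reLin y) • (1 : M) := by
  rw [one_conv, A.trace_eq_reLin hy, ← Complex.ofReal_mul, Complex.coe_smul]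

theorem conv_one_of_nonneg {x : M} (hx : 0 ≤ x) :
    A.conv x 1 = (k * A.τ.reLin x) • (1 : M) := by
  rw [conv_one, A.trace_eq_reLin hx, ← Complex.ofReal_mul, Complex.coe_smul]

theorem conv_le_of_norm_sub_le_right {x y y' : M} (hx : 0 ≤ x) (hy : 0 ≤ y) (hy' : 0 ≤ y') {s : ℝ}
    (h : ‖y - y'‖ ≤ s) : A.conv x y ≤ A.conv x y' + (s * (k * A.τ.reLin x)) • (1 : M) := by
  refine (A.conv_mono_right hx (le_add_smul_one_of_norm_sub_le hy hy' h)).trans_eq ?_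
  rw [map_add, LinearMap.map_smul_of_tower, A.conv_one_of_nonneg hx, smul_smul]

theorem conv_le_of_norm_sub_le_left {x x' y : M} (hx : 0 ≤ x) (hx' : 0 ≤ x') (hy : 0 ≤ y) {s : ℝ}
    (h : ‖x - x'‖ ≤ s) : A.conv x y ≤ A.conv x' y + (s * (k * A.τ.reLin y)) • (1 : M) := by
  refine (A.conv_mono_left (le_add_smul_one_of_norm_sub_le hx hx' h) hy).trans_eq ?_
  rw [map_add, LinearMap.map_smul_of_tower, LinearMap.add_apply, LinearMap.smul_apply,
    A.one_conv_of_nonneg hy, smul_smul]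

variable [FiniteDimensional ℂ M]

/-- Here `c ↦ c ∗ y` is doubly stochastic because `k τ(y) = 1`, and it maps `z'` close to
`z ∗ w`. -/
theorem entropy_left_le {z z' y w : M} (hz : 0 ≤ z) (hz' : 0 ≤ z') (hy : 0 ≤ y) (hw : 0 ≤ w)
    (hτ : k * A.τ.reLin y = 1) {r s δ : ℝ} (hr : ‖z' - z‖ ≤ r) (hs : ‖y - w‖ ≤ s)
    (hδ : r + s * (k * A.τ.reLin z) ≤ δ) :
    A.τ.entropy z' ≤ A.τ.entropy (A.conv z w) + A.τ.dim * Real.negMulLog δ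
      + 2 * δ * (A.τ.reLin (A.conv z w) + δ * A.τ.dim) := by
  have hk := A.k_pos
  have hδ0 : 0 ≤ δ := by
    have := mul_nonneg ((norm_nonneg _).trans hs) (mul_nonneg hk.le (A.τ.reLin_nonneg hz))
    linarith [(norm_nonneg _).trans hr]
  have hle : (r + s * (k * A.τ.reLin z)) • (1 : M) ≤ δ • 1 :=
    smul_le_smul_of_nonneg_right hδ zero_le_one
  rw [add_smul] at hle
  refine A.τ.entropy_le (A.conv.flip y) (fun c hc => A.conv_nonneg hc hy) ?_ (fun c => ?_) hz'
    (A.conv_nonneg hz hw) hδ0 ?_ ?_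
  · rw [LinearMap.flip_apply, A.one_conv_of_nonneg hy, hτ, one_smul]
  · rw [LinearMap.flip_apply, A.trace_conv, A.trace_eq_reLin hy, mul_left_comm,
      ← Complex.ofReal_mul, hτ, Complex.ofReal_one, mul_one]
  · have h1 := A.conv_le_of_norm_sub_le_left hz' hz hy hr
    have h2 := A.conv_le_of_norm_sub_le_right hz hy hw hs
    rw [hτ, mul_one] at h1
    rw [LinearMap.flip_apply]
    calc A.conv z' y ≤ A.conv z y + r • (1 : M) := h1
      _ ≤ A.conv z w + (s * (k * A.τ.reLin z)) • (1 : M) + r • (1 : M) := add_le_add_left h2 _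
      _ = A.conv z w + (r • (1 : M) + (s * (k * A.τ.reLin z)) • (1 : M)) := by abel
      _ ≤ A.conv z w + δ • (1 : M) := add_le_add_right hle _
  · rw [norm_sub_rev] at hr hs
    have h1 := A.conv_le_of_norm_sub_le_left hz hz' hy hr
    have h2 := A.conv_le_of_norm_sub_le_right hz hw hy hs
    rw [hτ, mul_one] at h1
    rw [LinearMap.flip_apply]
    calc A.conv z w ≤ A.conv z y + (s * (k * A.τ.reLin z)) • (1 : M) := h2
      _ ≤ A.conv z' y + r • (1 : M) + (s * (k * A.τ.reLin z)) • (1 : M) := add_le_add_left h1 _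
      _ = A.conv z' y + (r • (1 : M) + (s * (k * A.τ.reLin z)) • (1 : M)) := by abel
      _ ≤ A.conv z' y + δ • (1 : M) := add_le_add_right hle _

/-- Here `c ↦ x ∗ c` is doubly stochastic because `k τ(x) = 1`, and it maps `w'` close to
`z ∗ w`. -/
theorem entropy_right_le {x z w w' : M} (hx : 0 ≤ x) (hz : 0 ≤ z) (hw : 0 ≤ w) (hw' : 0 ≤ w')
    (hτ : k * A.τ.reLin x = 1) {r s δ : ℝ} (hr : ‖w' - w‖ ≤ r) (hs : ‖x - z‖ ≤ s)
    (hδ : r + s * (k * A.τ.reLin w) ≤ δ) :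
    A.τ.entropy w' ≤ A.τ.entropy (A.conv z w) + A.τ.dim * Real.negMulLog δ
      + 2 * δ * (A.τ.reLin (A.conv z w) + δ * A.τ.dim) := by
  have hk := A.k_pos
  have hδ0 : 0 ≤ δ := by
    have := mul_nonneg ((norm_nonneg _).trans hs) (mul_nonneg hk.le (A.τ.reLin_nonneg hw))
    linarith [(norm_nonneg _).trans hr]
  have hle : (r + s * (k * A.τ.reLin w)) • (1 : M) ≤ δ • 1 :=
    smul_le_smul_of_nonneg_right hδ zero_le_one
  rw [add_smul] at hle
  refine A.τ.entropy_le (A.conv x) (fun c hc => A.conv_nonneg hx hc) ?_ (fun c => ?_) hw'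
    (A.conv_nonneg hz hw) hδ0 ?_ ?_
  · rw [A.conv_one_of_nonneg hx, hτ, one_smul]
  · rw [A.trace_conv, A.trace_eq_reLin hx, ← mul_assoc,
      ← Complex.ofReal_mul, hτ, Complex.ofReal_one, one_mul]
  · have h1 := A.conv_le_of_norm_sub_le_right hx hw' hw hr
    have h2 := A.conv_le_of_norm_sub_le_left hx hz hw hs
    rw [hτ, mul_one] at h1
    calc A.conv x w' ≤ A.conv x w + r • (1 : M) := h1
      _ ≤ A.conv z w + (s * (k * A.τ.reLin w)) • (1 : M) + r • (1 : M) := add_le_add_left h2 _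
      _ = A.conv z w + (r • (1 : M) + (s * (k * A.τ.reLin w)) • (1 : M)) := by abel
      _ ≤ A.conv z w + δ • (1 : M) := add_le_add_right hle _
  · rw [norm_sub_rev] at hr hs
    have h1 := A.conv_le_of_norm_sub_le_right hx hw hw' hr
    have h2 := A.conv_le_of_norm_sub_le_left hz hx hw hs
    rw [hτ, mul_one] at h1
    calc A.conv z w ≤ A.conv x w + (s * (k * A.τ.reLin w)) • (1 : M) := h2
      _ ≤ A.conv x w' + r • (1 : M) + (s * (k * A.τ.reLin w)) • (1 : M) := add_le_add_left h1 _
      _ = A.conv x w' + (r • (1 : M) + (s * (k * A.τ.reLin w)) • (1 : M)) := by abel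
      _ ≤ A.conv x w' + δ • (1 : M) := add_le_add_right hle _

end FNAlgebra

/-! ### The error term -/

theorem abs_mul_log_eq_negMulLog {t : ℝ} (h0 : 0 ≤ t) (h1 : t ≤ 1) :
    |t * Real.log t| = Real.negMulLog t := by
  rw [abs_of_nonpos (mul_nonpos_of_nonneg_of_nonpos h0 (Real.log_nonpos h0 h1)), Real.negMulLog,
    neg_mul]

theorem mul_log_le_negMulLog {R t : ℝ} (h0 : 0 ≤ t) (h : t ≤ 1 / R) :
    t * Real.log R ≤ Real.negMulLog t := by
  rcases h0.eq_or_lt with rfl | h0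
  · simp
  · have h1 := Real.log_le_log h0 h
    rw [one_div, Real.log_inv] at h1
    rw [Real.negMulLog]
    nlinarith

theorem negMulLog_mul_le {a t : ℝ} (ha : 1 ≤ a) (ht : 0 ≤ t) :
    Real.negMulLog (a * t) ≤ a * Real.negMulLog t := by
  rw [Real.negMulLog_mul, Real.negMulLog]
  nlinarith [mul_nonneg (mul_nonneg ht (by linarith : 0 ≤ a)) (Real.log_nonneg ha)]

/-- With `ε + η ≤ 1 / R` and `R > 1`, linear terms are absorbed: `t log R ≤ -t log t` for
`0 ≤ t ≤ 1 / R`. -/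
theorem error_le {a d N R ε η β : ℝ} (ha : 1 ≤ a) (hd : 0 ≤ d) (hR : 1 < R) (hN : 0 ≤ N)
    (hε0 : 0 ≤ ε) (hε1 : ε ≤ 1) (hη0 : 0 ≤ η) (hη1 : η ≤ 1) (h : ε + η ≤ 1 / R) (hβ : β ≤ N) :
    d * Real.negMulLog (a * (ε + η)) + 2 * (a * (ε + η)) * (β + a * (ε + η) * d)
      ≤ (d * a + 2 * a * (N + 2 * a * d) / Real.log R) * |ε * Real.log ε|
        + (d * a + 2 * a * (N + 2 * a * d) / Real.log R) * |η * Real.log η| := by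
  have hlog := Real.log_pos hR
  rw [abs_mul_log_eq_negMulLog hε0 hε1, abs_mul_log_eq_negMulLog hη0 hη1]
  have h1 := mul_log_le_negMulLog hε0 (by linarith : ε ≤ 1 / R)
  have h2 := mul_log_le_negMulLog hη0 (by linarith : η ≤ 1 / R)
  have h3 := mul_le_mul_of_nonneg_left ((negMulLog_mul_le ha (add_nonneg hε0 hη0)).trans
    (mul_le_mul_of_nonneg_left (negMulLog_add_le hε0 hη0) (by linarith))) hd
  have h4 : a * (ε + η) * d ≤ 2 * a * d := by
    have := mul_le_mul_of_nonneg_left (by linarith : ε + η ≤ 2) (by positivity : 0 ≤ a * d)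
    linarith
  have h5 : 2 * (a * (ε + η)) * (β + a * (ε + η) * d)
      ≤ 2 * (a * (ε + η)) * (N + 2 * a * d) := by
    have : 0 ≤ 2 * (a * (ε + η)) := by positivity
    exact mul_le_mul_of_nonneg_left (by linarith) this
  have h6 : ε + η ≤ (Real.negMulLog ε + Real.negMulLog η) / Real.log R := by
    rw [le_div_iff₀ hlog]
    linarith
  have h7 := mul_le_mul_of_nonneg_left h6 (by positivity : 0 ≤ 2 * a * (N + 2 * a * d))
  have h8 : 2 * a * (N + 2 * a * d) * ((Real.negMulLog ε + Real.negMulLog η) / Real.log R)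
      = 2 * a * (N + 2 * a * d) / Real.log R * Real.negMulLog ε
        + 2 * a * (N + 2 * a * d) / Real.log R * Real.negMulLog η := by ring
  linarith

end

/-! ### The smooth entropic convolution inequality -/

theorem theorem4p7 (d lam k : ℝ) :
    ∃ C : ℝ, 0 ≤ C ∧
      ∀ (M : Type u) [CStarAlgebra M] [PartialOrder M] [StarOrderedRing M]
        [FiniteDimensional ℂ M] (A : FNAlgebra k M),
        A.τ.dim = d → A.τ.minTrace = lam →
        ∀ (p q : ℝ≥0∞), 1 ≤ p → 1 ≤ q →
        ∀ (ε η : ℝ), 0 ≤ ε → ε ≤ 1 → 0 ≤ η → η ≤ 1 →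
          ε + η ≤ 1 / ((d + 1) * (1 + k * (d + 1))) →
        ∀ (x y : M), 0 ≤ x → 0 ≤ y → A.τ.pNorm 1 x = k⁻¹ → A.τ.pNorm 1 y = k⁻¹ →
        ∀ (θ : ℝ), 0 ≤ θ → θ ≤ 1 →
          A.smoothConvEntropy p q ε η x y ≥
            θ * A.τ.smoothEntropy p ε x + (1 - θ) * A.τ.smoothEntropy q η y
              - C * |ε * Real.log ε| - C * |η * Real.log η| := by
  -- Unless `d`, `lam` and `k` are positive, no algebra meets the hypotheses.
  by_cases hpos : 0 < d ∧ 0 < lam ∧ 0 < k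
  swap
  · refine ⟨0, le_rfl, ?_⟩
    intro M _ _ _ _ A hd hlam p q _ _ ε η _ _ _ _ _ x y _ _ hx
    have hk := A.k_pos
    have : Nontrivial M := by
      by_contra hM
      rw [not_nontrivial_iff_subsingleton] at hM
      rw [Subsingleton.elim x 0, A.τ.pNorm_zero le_rfl] at hx
      exact (inv_pos.2 hk).ne hx
    exact absurd ⟨hd ▸ A.τ.dim_pos, hlam ▸ A.τ.minTrace_pos, hk⟩ hpos
  obtain ⟨hd0, hlam0, hk⟩ := hpos
  -- `K` compares the operator norm with the `p`-norms, `t` bounds the traces of all elements within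
  -- distance `1` of `x` or `y`, and `a * (ε + η)` bounds the displacement in operator norm.
  obtain ⟨K, hK⟩ : ∃ K, K = 1 + lam⁻¹ := ⟨_, rfl⟩
  have hK0 : 0 < K := by rw [hK]; positivity
  obtain ⟨t, ht⟩ : ∃ t, t = (K * k⁻¹ + K) * d := ⟨_, rfl⟩
  have ht0 : 0 < t := by rw [ht]; positivity
  obtain ⟨a, ha⟩ : ∃ a, a = 2 * K + K * (k * t) + 1 := ⟨_, rfl⟩
  have ha1 : 1 ≤ a := by
    rw [ha]
    have : 0 ≤ 2 * K + K * (k * t) := by positivity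
    linarith
  have hR : 1 < (d + 1) * (1 + k * (d + 1)) := by nlinarith [mul_pos hk hd0]
  have hlogR := Real.log_pos hR
  refine ⟨d * a + 2 * a * (k * (t * t) + 2 * a * d) / Real.log ((d + 1) * (1 + k * (d + 1))),
    by positivity, ?_⟩
  intro M _ _ _ _ A hd hlam p q hp hq ε η hε0 hε1 hη0 hη1 hsum x y hx hy hxn hyn θ hθ0 hθ1
  have : Nontrivial M := by
    by_contra hM
    rw [not_nontrivial_iff_subsingleton] at hM
    rw [Subsingleton.elim x 0, A.τ.pNorm_zero le_rfl] at hxn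
    exact (inv_pos.2 hk).ne hxn
  have hnorm : ∀ {p : ℝ≥0∞}, 1 ≤ p → ∀ {c : M} {s : ℝ}, A.τ.pNorm p c ≤ s → ‖c‖ ≤ K * s := by
    intro p hp c s hc
    rw [hK, ← hlam]
    exact A.τ.norm_le_of_pNorm_le hp hc
  have hxτ : k * A.τ.reLin x = 1 := by
    rw [← A.τ.pNorm_one_of_nonneg hx, hxn, mul_inv_cancel₀ hk.ne']
  have hyτ : k * A.τ.reLin y = 1 := by
    rw [← A.τ.pNorm_one_of_nonneg hy, hyn, mul_inv_cancel₀ hk.ne']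
  have htr : ∀ {x z : M} {s : ℝ}, A.τ.pNorm 1 x = k⁻¹ → 0 ≤ z → s ≤ 1 → ‖x - z‖ ≤ K * s →
      A.τ.reLin z ≤ t := by
    intro x z s hx hz hs hxz
    have h1 := hnorm le_rfl hx.le
    have h2 : ‖z‖ ≤ K * k⁻¹ + K := by
      have h3 := norm_sub_norm_le z x
      rw [norm_sub_rev] at h3
      nlinarith
    calc A.τ.reLin z ≤ ‖z‖ * A.τ.dim := A.τ.reLin_le_norm_mul_dim hz
      _ ≤ t := by rw [ht, hd]; exact mul_le_mul_of_nonneg_right h2 hd0.le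
  set C := d * a + 2 * a * (k * (t * t) + 2 * a * d) / Real.log ((d + 1) * (1 + k * (d + 1)))
  have hdisp : ∀ {u v s : ℝ}, 0 ≤ u → 0 ≤ v → s ≤ t →
      (K * u + K * u) + K * v * (k * s) ≤ a * (u + v) := by
    intro u v s hu hv hs
    have h1 : K * v * (k * s) ≤ K * v * (k * t) := by gcongr
    have h2 : 0 ≤ K * (k * t) * u := by positivity
    have h3 : 0 ≤ K * v := by positivity
    rw [ha]
    linarith
  refine le_csInf ⟨_, x, y, hx, hy, ?_, ?_, rfl⟩ ?_
  · rw [sub_self, A.τ.pNorm_zero hp]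
    exact hε0
  · rw [sub_self, A.τ.pNorm_zero hq]
    exact hη0
  rintro h ⟨z, w, hz, hw, hxz, hyw, rfl⟩
  have hxz' := hnorm hp hxz
  have hyw' := hnorm hq hyw
  have hzt := htr hxn hz hε1 hxz'
  have hwt := htr hyn hw hη1 hyw'
  have hzwt : A.τ.reLin (A.conv z w) ≤ k * (t * t) := by
    have h1 : A.τ.reLin (A.conv z w) = k * (A.τ.reLin z * A.τ.reLin w) := by
      rw [FaithfulTrace.reLin_apply, A.trace_conv, A.trace_eq_reLin hz, A.trace_eq_reLin hw,
        ← Complex.ofReal_mul, ← Complex.ofReal_mul, Complex.ofReal_re]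
    rw [h1]
    have := A.τ.reLin_nonneg hw
    gcongr
  have herr := error_le ha1 hd0.le hR (by positivity) hε0 hε1 hη0 hη1 hsum hzwt
  have hleft : A.τ.smoothEntropy p ε x
      ≤ A.τ.entropy (A.conv z w) + (C * |ε * Real.log ε| + C * |η * Real.log η|) := by
    refine csSup_le ⟨_, x, hx, ?_, rfl⟩ ?_
    · rw [sub_self, A.τ.pNorm_zero hp]
      exact hε0
    rintro _ ⟨z', hz', hz'x, rfl⟩
    have hr : ‖z' - z‖ ≤ K * ε + K * ε :=
      (norm_sub_le_norm_sub_add_norm_sub z' x z).trans (add_le_add (hnorm hp hz'x) hxz')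
    have := A.entropy_left_le hz hz' hy hw hyτ hr hyw' (hdisp hε0 hη0 hzt)
    rw [hd] at this
    linarith
  have hright : A.τ.smoothEntropy q η y
      ≤ A.τ.entropy (A.conv z w) + (C * |ε * Real.log ε| + C * |η * Real.log η|) := by
    refine csSup_le ⟨_, y, hy, ?_, rfl⟩ ?_
    · rw [sub_self, A.τ.pNorm_zero hq]
      exact hη0
    rintro _ ⟨w', hw', hw'y, rfl⟩
    have hr : ‖w' - w‖ ≤ K * η + K * η :=
      (norm_sub_le_norm_sub_add_norm_sub w' y w).trans (add_le_add (hnorm hq hw'y) hyw')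
    have hδ := hdisp hη0 hε0 hwt
    rw [add_comm η ε] at hδ
    have := A.entropy_right_le hx hz hw hw' hxτ hr hxz' hδ
    rw [hd] at this
    linarith
  have h1 := mul_le_mul_of_nonneg_left hleft hθ0
  have h2 := mul_le_mul_of_nonneg_left hright (sub_nonneg.2 hθ1)
  linarith
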